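/- A graphical model is a simple graph $G$ on a finite vertex set $V$ together with integers $d_v\ge 1$ ($v\in V$), the numbers of states of its vertices. For $C\subseteq V$ put $\mathcal R_C=\prod_{v\in C}[d_v]$, where $[d]=\{1,\dots,d\}$. The parametrization matrix $A_G$ is the $0/1$ matrix whose columns are indexed by $\mathcal R_V$, whose rows are indexed by the pairs $(C,a)$ with $C$ a maximal clique of $G$ and $a\in\mathcal R_C$, and whose entry in row $(C,a)$ and column $x$ is $1$ if $a_v=x_v$ for all $v\in C$, and $0$ otherwise. Let $\mathcal M_G\subseteq\mathbb P_{\mathbb C}^{|\mathcal R_V|-1}$ be the projective toric variety of $A_G$, i.e. the Zariski closure of the set of points $\left(\prod_{C}\sigma^{(C)}_{x_C}\right)_{x\in\mathcal R_V}$ with all $\sigma^{(C)}_{a}\in\mathbb C^*$, the product being over the maximal cliques $C$ of $G$. Write $\deg(G)=\deg(\mathcal M_G)$ and $\dim(G)=\dim(\mathcal M_G)$. The join $G_1\vee G_2$ of two graphical models is the graphical model on the disjoint union of their vertex sets (each vertex keeping its number of states) whose edges are those of $G_1$, those of $G_2$, and all edges between a vertex of $G_1$ and a vertex of $G_2$.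 **Theorem.** Let $K_p$ be a $p$-clique (a complete graph on $p$ vertices, with any positive numbers of states) and let $G$ be a graphical model. Then $$\deg(K_p\vee G)=\deg(G)^{\dim(K_p)+1}.$$ Moreover, up to relabeling of its rows and columns, the parametrization matrix $A_{K_p\vee G}$ is block-diagonal with $\dim(K_p)+1$ diagonal blocks, each equal to $A_G$. Finally, for all $m,n\ge0$ and all irreducible projective varieties $Y\subseteq\mathbb P_{\mathbb C}^m$ and $Z\subseteq\mathbb P_{\mathbb C}^n$, the join $$J(Y,Z)=\{(\lambda y_0:\dots:\lambda y_m:\mu z_0:\dots:\mu z_n)\mid (y_0:\dots:y_m)\in Y,\ (z_0:\dots:z_n)\in Z,\ \lambda,\mu\in\mathbb C\text{ not both }0\}\subseteq\mathbb P_{\mathbb C}^{m+n+1}$$ satisfies $\deg(J(Y,Z))=\deg(Y)\cdot\deg(Z)$. -/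

import Mathlib

open scoped LinearAlgebra.Projectivization Topology

noncomputable section

namespace GraphicalDegree

/-! ### Projective varieties over the complex numbers, their dimension and degree -/

section Projective

variable {σ τ : Type*}

/-- The points of projective space with homogeneous coordinates indexed by `σ` at which all the
polynomials of `S` vanish. Used only for sets `S` of homogeneous polynomials, for which it does
not depend on the chosen representatives. -/
def projZeroLocus (S : Set (MvPolynomial σ ℂ)) : Set (ℙ ℂ (σ → ℂ)) :=
  {P | ∀ f ∈ S, MvPolynomial.eval P.rep f = 0}

/-- Zariski closed sets: common zeros of a set of homogeneous polynomials. -/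
def IsProjAlgebraic (Z : Set (ℙ ℂ (σ → ℂ))) : Prop :=
  ∃ S : Set (MvPolynomial σ ℂ), (∀ f ∈ S, ∃ k : ℕ, f.IsHomogeneous k) ∧ Z = projZeroLocus S

/-- The Zariski topology on projective space. -/
@[reducible]
def zariski (σ : Type*) : TopologicalSpace (ℙ ℂ (σ → ℂ)) :=
  TopologicalSpace.ofClosed {Z | IsProjAlgebraic Z}
    (by
      refine ⟨{1}, ?_, ?_⟩
      · rintro f rfl
        exact ⟨0, MvPolynomial.isHomogeneous_one _ _⟩
      · ext P
        simp [projZeroLocus])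
    (by
      intro A hA
      refine ⟨{f | ∃ Z ∈ A, (∃ k : ℕ, f.IsHomogeneous k) ∧
        ∀ P ∈ Z, MvPolynomial.eval P.rep f = 0}, ?_, ?_⟩
      · rintro f ⟨Z, -, hf, -⟩
        exact hf
      · ext P
        constructor
        · rintro hP f ⟨Z, hZ, -, hf⟩
          exact hf P (hP Z hZ)
        · intro hP Z hZ
          obtain ⟨S, hS, hZS⟩ := hA hZ
          rw [hZS]
          intro f hf
          refine hP f ⟨Z, hZ, hS f hf, ?_⟩
          intro Q hQ
          rw [hZS] at hQ
          exact hQ f hf)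
    (by
      rintro A ⟨S, hS, rfl⟩ B ⟨T, hT, rfl⟩
      refine ⟨{h | ∃ f ∈ S, ∃ g ∈ T, h = f * g}, ?_, ?_⟩
      · rintro h ⟨f, hf, g, hg, rfl⟩
        obtain ⟨k, hk⟩ := hS f hf
        obtain ⟨l, hl⟩ := hT g hg
        exact ⟨k + l, hk.mul hl⟩
      · ext P
        constructor
        · rintro (hP | hP) h ⟨f, hf, g, hg, rfl⟩
          · simp [hP f hf]
          · simp [hP g hg]
        · intro hP
          by_contra hcon
          simp only [projZeroLocus, Set.mem_union, Set.mem_ofPred_eq, not_or, not_forall] at hcon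
          obtain ⟨⟨f, hf, hfP⟩, ⟨g, hg, hgP⟩⟩ := hcon
          have := hP (f * g) ⟨f, hf, g, hg, rfl⟩
          rw [map_mul] at this
          rcases mul_eq_zero.1 this with h | h
          · exact hfP h
          · exact hgP h)

/-- An irreducible projective variety: a Zariski closed, (nonempty) irreducible subset of
projective space. -/
def IsIrreducibleVariety (Z : Set (ℙ ℂ (σ → ℂ))) : Prop :=
  IsClosed[zariski σ] Z ∧ @IsIrreducible _ (zariski σ) Z

/-- The nonzero vectors that represent a point of `Z`. -/
def cone (Z : Set (ℙ ℂ (σ → ℂ))) : Set (σ → ℂ) :=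
  {v | ∃ hv : v ≠ 0, Projectivization.mk ℂ v hv ∈ Z}

/-- The homogeneous vanishing ideal `I(Z)`. (The field being infinite, a polynomial vanishes at all
representatives of all points of `Z` iff all its homogeneous components vanish on `Z`.) -/
def projIdeal (Z : Set (ℙ ℂ (σ → ℂ))) : Ideal (MvPolynomial σ ℂ) :=
  MvPolynomial.vanishingIdeal ℂ (cone Z)

/-- The homogeneous coordinate ring `ℂ[x] / I(Z)`. -/
abbrev coordRing (Z : Set (ℙ ℂ (σ → ℂ))) : Type _ :=
  MvPolynomial σ ℂ ⧸ projIdeal Z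

/-- The dimension of a nonempty projective variety: one less than the Krull dimension of its
homogeneous coordinate ring. -/
def projDim (Z : Set (ℙ ℂ (σ → ℂ))) : ℕ :=
  ((ringKrullDim (coordRing Z)).unbotD 0).toNat - 1

/-- The Hilbert function: the dimension of the degree `k` part of the homogeneous coordinate
ring. -/
def hilbertFunction (Z : Set (ℙ ℂ (σ → ℂ))) (k : ℕ) : ℕ :=
  Module.finrank ℂ
    ((MvPolynomial.homogeneousSubmodule σ ℂ k).map
      (Ideal.Quotient.mkₐ ℂ (projIdeal Z)).toLinearMap)

open Classical in
/-- The Hilbert polynomial: the polynomial whose value at `k` is the Hilbert function at `k` for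
all large `k`. -/
def hilbertPolynomial (Z : Set (ℙ ℂ (σ → ℂ))) : Polynomial ℚ :=
  if h : ∃ p : Polynomial ℚ, ∀ᶠ k : ℕ in Filter.atTop,
      p.eval (k : ℚ) = (hilbertFunction Z k : ℚ) then h.choose else 0

/-- Any polynomial that eventually agrees with the Hilbert function is the Hilbert polynomial. -/
theorem hilbertPolynomial_eq (Z : Set (ℙ ℂ (σ → ℂ))) (p : Polynomial ℚ)
    (hp : ∀ᶠ k : ℕ in Filter.atTop, p.eval (k : ℚ) = (hilbertFunction Z k : ℚ)) :
    hilbertPolynomial Z = p := by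
  have h : ∃ p : Polynomial ℚ, ∀ᶠ k : ℕ in Filter.atTop,
      p.eval (k : ℚ) = (hilbertFunction Z k : ℚ) := ⟨p, hp⟩
  rw [hilbertPolynomial, dif_pos h]
  obtain ⟨N, hN⟩ := Filter.eventually_atTop.1 (h.choose_spec.and hp)
  refine Polynomial.eq_of_infinite_eval_eq _ _
    (Set.Infinite.mono (s := (Nat.cast : ℕ → ℚ) '' Set.Ici N) ?_ ?_)
  · rintro _ ⟨k, hk, rfl⟩
    exact (hN k hk).1.trans (hN k hk).2.symm
  · exact (Set.Ici_infinite N).image Nat.cast_injective.injOn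

/-- The degree of a projective variety: if the Hilbert polynomial has degree `r`, it is `r!` times
its leading coefficient. -/
def projDegree (Z : Set (ℙ ℂ (σ → ℂ))) : ℚ :=
  ((hilbertPolynomial Z).natDegree.factorial : ℚ) * (hilbertPolynomial Z).leadingCoeff

/-- The join of two projective varieties, placed in complementary coordinate subspaces: the points
`(a y : b z)` with `(y) ∈ Y`, `(z) ∈ Z` and scalars `a`, `b`, not both zero. -/
def joinVariety (Y : Set (ℙ ℂ (σ → ℂ))) (Z : Set (ℙ ℂ (τ → ℂ))) : Set (ℙ ℂ (σ ⊕ τ → ℂ)) :=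
  {P | ∃ y ∈ cone Y, ∃ z ∈ cone Z, ∃ a b : ℂ, ∃ h : Sum.elim (a • y) (b • z) ≠ 0,
    P = Projectivization.mk ℂ (Sum.elim (a • y) (b • z)) h}

/-- The projective toric variety `X_A` of an integer matrix `A`: the Zariski closure of the image of
the torus under the monomials given by the columns of `A`. -/
def toricVariety {ρ : Type*} [Fintype ρ] (A : Matrix ρ σ ℤ) : Set (ℙ ℂ (σ → ℂ)) :=
  @closure _ (zariski σ)
    {P | ∃ t : ρ → ℂˣ, ∃ h : (fun j => ((∏ i, t i ^ A i j : ℂˣ) : ℂ)) ≠ 0,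
      P = Projectivization.mk ℂ (fun j => ((∏ i, t i ^ A i j : ℂˣ) : ℂ)) h}

end Projective

/-! ### Discrete undirected graphical models

A graphical model is a graph `G` on a finite vertex set `V` together with the numbers `d v` of
states of its vertices. -/

section Models

variable {V W : Type*}

/-- The state space of a set `C` of vertices: the product of the sets `[d v]`, `v ∈ C`. -/
abbrev StateOn (d : V → ℕ) (C : Finset V) : Type _ := (v : C) → Fin (d v)

/-- The state space of all vertices. -/
abbrev State (d : V → ℕ) : Type _ := (v : V) → Fin (d v)

/-- The maximal cliques of `G`. -/
abbrev MaxClique (G : SimpleGraph V) : Type _ :=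
  {C : Finset V // Maximal (fun s : Finset V => G.IsClique (s : Set V)) C}

/-- The row labels of the parametrization matrix: a maximal clique with a state of its vertices. -/
abbrev Row (G : SimpleGraph V) (d : V → ℕ) : Type _ := (C : MaxClique G) × StateOn d C.1

instance instFintypeMaxClique [Finite V] (G : SimpleGraph V) : Fintype (MaxClique G) :=
  Fintype.ofFinite _

instance instFintypeRow [Finite V] (G : SimpleGraph V) (d : V → ℕ) : Fintype (Row G d) :=
  Fintype.ofFinite _

open Classical in
/-- The parametrization matrix `A_G`. -/
def paramMatrix (G : SimpleGraph V) (d : V → ℕ) : Matrix (Row G d) (State d) ℤ :=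
  fun r x => if ∀ v : r.1.1, r.2 v = x v then 1 else 0

/-- The parametrized undirected graphical model `M_G`. -/
def model [Finite V] (G : SimpleGraph V) (d : V → ℕ) : Set (ℙ ℂ (State d → ℂ)) :=
  toricVariety (paramMatrix G d)

/-- The monomials that parametrize `M_G` are the products over the maximal cliques `C` of the
parameters `t` with index `(C, x_C)`. -/
theorem prod_paramMatrix [Finite V] (G : SimpleGraph V) (d : V → ℕ) (t : Row G d → ℂˣ)
    (x : State d) :
    ∏ r, t r ^ paramMatrix G d r x = ∏ C : MaxClique G, t ⟨C, fun v => x v⟩ := by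
  classical
  have h : ∀ r : Row G d, t r ^ paramMatrix G d r x =
      if (⟨r.1, fun v => x v⟩ : Row G d) = r then t r else 1 := by
    rintro ⟨C, a⟩
    by_cases ha : ∀ v : C.1, a v = x v
    · have h1 : (⟨C, fun v => x v⟩ : Row G d) = ⟨C, a⟩ := by
        congr 1
        funext v
        exact (ha v).symm
      rw [if_pos h1, paramMatrix, if_pos ha, zpow_one]
    · have h1 : ¬ (⟨C, fun v => x v⟩ : Row G d) = ⟨C, a⟩ := by
        intro h2
        have h3 : (fun v : C.1 => x v) = a := eq_of_heq (Sigma.mk.inj h2).2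
        exact ha fun v => (congrFun h3 v).symm
      rw [if_neg h1, paramMatrix, if_neg ha, zpow_zero]
  simp only [h]
  rw [← Finset.prod_filter]
  symm
  refine Finset.prod_bij (fun C _ => (⟨C, fun v => x v⟩ : Row G d)) ?_ ?_ ?_ ?_
  · intro C _
    simp
  · intro C _ C' _ hCC
    exact congrArg Sigma.fst hCC
  · intro r hr
    exact ⟨r.1, Finset.mem_univ _, (Finset.mem_filter.1 hr).2⟩
  · intro C _
    rfl

/-- The join of two graphs: all edges of `G`, all edges of `H`, and all edges between a vertex of
`G` and a vertex of `H`. -/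
def graphJoin (G : SimpleGraph V) (H : SimpleGraph W) : SimpleGraph (V ⊕ W) where
  Adj
    | Sum.inl u, Sum.inl v => G.Adj u v
    | Sum.inr u, Sum.inr v => H.Adj u v
    | Sum.inl _, Sum.inr _ => True
    | Sum.inr _, Sum.inl _ => True
  symm := ⟨by
    rintro (u | u) (v | v) h
    · exact G.adj_symm h
    · trivial
    · trivial
    · exact H.adj_symm h⟩
  loopless := ⟨by
    rintro (u | u) h
    · exact G.loopless.irrefl u h
    · exact H.loopless.irrefl u h⟩

end Models

end GraphicalDegree

end

/-! Everything is read off Hilbert series. For a set `A` of vectors, `hilb A k` is the dimension of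
the space of functions on `A` given by forms of degree `k`; on the cone of a projective set it is
the Hilbert function. If the series `∑ hilb A k X^k` equals `p / (1 - X)^(d+1)` with `p(1) ≠ 0`, the
degree is `p(1)` (`projDegree_eq_of_hasDegree`). Rationality of the series follows from counting
standard monomials, i.e. the complement of an upper set in `ℕ^n` (`exists_complSeries_mul_eq`,
`exists_series_mul_eq`).

For scale-stable sets the series of a product is the product of the series (`hilb_prodSet`): pole
orders add and the values `p(1)` multiply. A form vanishes on the cone over a join exactly when it
vanishes on the product of the two cones, so degrees multiply under joins (`hilb_cone_joinVariety`,
`projDegree_joinVariety`).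

For the models, the maximal cliques of `K ∨ G` are `K ∪ C` with `C` a maximal clique of `G`. A row
and a column of the matrix can meet in a `1` only if they agree on `K`, so there is one block `A_G`
for each state of `K` (`paramMatrix_graphJoin`). The torus image of a block-diagonal matrix is a
product of torus images, which gives a power of the degree. The exponent is right because the model
of `K` is a full projective space, whose coordinates are the states of `K` (`projDim_model_top`). -/

noncomputable section

namespace GraphicalDegree

/-! ### Counting the complement of an upper set of exponents -/

section Counting

/-- The exponents of total degree `k` outside of `U`. -/
def complDegree {n : ℕ} (U : Set (Fin n → ℕ)) (k : ℕ) : Set (Fin n → ℕ) :=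
  {a | a ∉ U ∧ ∑ i, a i = k}

/-- The generating series of the number of exponents of given degree outside of `U`. -/
def complSeries {n : ℕ} (U : Set (Fin n → ℕ)) : PowerSeries ℚ :=
  PowerSeries.mk fun k => ((complDegree U k).ncard : ℚ)

theorem finite_sum_eq {σ : Type*} [Fintype σ] (k : ℕ) : {a : σ → ℕ | ∑ i, a i = k}.Finite := by
  classical
  refine (Finset.finite_toSet (Finset.piAntidiag Finset.univ k)).subset fun a ha => ?_
  simpa using ha

theorem finite_complDegree {n : ℕ} (U : Set (Fin n → ℕ)) (k : ℕ) : (complDegree U k).Finite :=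
  (finite_sum_eq k).subset fun _ ha => ha.2

/-- Prepending a zero to an exponent. -/
def consZero {n : ℕ} (b : Fin n → ℕ) : Fin (n + 1) → ℕ := Fin.cons 0 b

theorem complDegree_zero {n : ℕ} (U : Set (Fin (n + 1) → ℕ)) :
    complDegree U 0 = consZero '' complDegree (consZero ⁻¹' U) 0 := by
  ext a
  constructor
  · rintro ⟨h1, h2⟩
    rw [Fin.sum_univ_succ] at h2
    have h0 : consZero (Fin.tail a) = a := by
      conv_rhs => rw [← Fin.cons_self_tail a]
      rw [show a 0 = 0 by omega, consZero]
    refine ⟨Fin.tail a, ⟨?_, ?_⟩, h0⟩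
    · rw [Set.mem_preimage, h0]
      exact h1
    · exact (Nat.add_eq_zero_iff.1 h2).2
  · rintro ⟨b, ⟨h1, h2⟩, rfl⟩
    exact ⟨h1, by simpa [consZero, Fin.sum_univ_succ] using h2⟩

theorem complDegree_succ {n : ℕ} (U : Set (Fin (n + 1) → ℕ)) (k : ℕ) :
    complDegree U (k + 1) = consZero '' complDegree (consZero ⁻¹' U) (k + 1) ∪
      (· + Pi.single 0 1) '' complDegree ((· + Pi.single 0 1) ⁻¹' U) k := by
  ext a
  constructor
  · rintro ⟨h1, h2⟩
    rcases Nat.eq_zero_or_pos (a 0) with h | h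
    · left
      have h0 : consZero (Fin.tail a) = a := by
        conv_rhs => rw [← Fin.cons_self_tail a]
        rw [h, consZero]
      refine ⟨Fin.tail a, ⟨?_, ?_⟩, h0⟩
      · rw [Set.mem_preimage, h0]
        exact h1
      · rw [Fin.sum_univ_succ, h, zero_add] at h2
        exact h2
    · right
      have h0 : a - Pi.single 0 1 + Pi.single 0 1 = a := by
        refine tsub_add_cancel_of_le fun i => ?_
        rcases eq_or_ne i 0 with rfl | hi
        · exact le_of_eq_of_le (Pi.single_eq_same _ _) h
        · simp [hi]
      refine ⟨a - Pi.single 0 1, ⟨?_, ?_⟩, h0⟩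
      · rw [Set.mem_preimage, h0]
        exact h1
      · rw [← h0] at h2
        simp only [Pi.add_apply, Finset.sum_add_distrib, Finset.sum_pi_single',
          Finset.mem_univ, if_true] at h2
        simpa using h2
  · rintro (⟨b, ⟨h1, h2⟩, rfl⟩ | ⟨b, ⟨h1, h2⟩, rfl⟩)
    · exact ⟨h1, by simpa [consZero, Fin.sum_univ_succ] using h2⟩
    · refine ⟨h1, ?_⟩
      simp [Finset.sum_add_distrib, h2]

/-- Splits exponents by whether their first entry vanishes. For a monomial ideal `I` this is the
exact sequence relating `R/(I : x₀)(-1)`, `R/I` and `R/(I, x₀)`. -/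
theorem complSeries_eq {n : ℕ} (U : Set (Fin (n + 1) → ℕ)) :
    complSeries U = complSeries (consZero ⁻¹' U) +
      PowerSeries.X * complSeries ((· + Pi.single 0 1) ⁻¹' U) := by
  have hinj : Function.Injective (consZero (n := n)) :=
    Fin.cons_right_injective (α := fun _ => ℕ) _
  ext k
  cases k with
  | zero =>
    simp only [complSeries, map_add, PowerSeries.coeff_mk, PowerSeries.coeff_zero_X_mul, add_zero]
    rw [complDegree_zero, Set.ncard_image_of_injective _ hinj]
  | succ k =>
    simp only [complSeries, map_add, PowerSeries.coeff_mk, PowerSeries.coeff_succ_X_mul]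
    rw [complDegree_succ, Set.ncard_union_eq ?_ ((finite_complDegree _ _).image _)
      ((finite_complDegree _ _).image _), Set.ncard_image_of_injective _ hinj,
      Set.ncard_image_of_injective _ (add_left_injective _), Nat.cast_add]
    rw [Set.disjoint_left]
    rintro _ ⟨b, -, rfl⟩ ⟨c, -, h⟩
    simpa [consZero] using congrFun h 0

/-- Ascending chain condition. A strict chain yields `a i` in the `(i+1)`-st set but not in the
`i`-th; the well-quasi-order gives `a i ≤ a j` with `i < j`, which forces `a j` into the `j`-th set.
-/
theorem wellFounded_isUpperSet {α : Type*} [Preorder α] [WellQuasiOrderedLE α] :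
    WellFounded fun U V : {U : Set α // IsUpperSet U} => V.1 ⊂ U.1 := by
  let r : {U : Set α // IsUpperSet U} → {U : Set α // IsUpperSet U} → Prop :=
    fun U V => V.1 ⊂ U.1
  have : IsStrictOrder _ r :=
    { irrefl := fun U h => h.ne rfl
      trans := fun U V W h1 h2 => h2.trans h1 }
  change WellFounded r
  rw [RelEmbedding.wellFounded_iff_isEmpty]
  refine ⟨fun f => ?_⟩
  have hlt : ∀ {i j}, i < j → (f i).1 ⊂ (f j).1 := fun h => f.map_rel_iff.2 h
  choose a ha ha' using fun i : ℕ => Set.exists_of_ssubset (hlt (Nat.lt_succ_self i))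
  obtain ⟨i, j, hij, h⟩ := wellQuasiOrdered_le a
  refine ha' j ((f j).2 h ?_)
  rcases (Nat.succ_le_of_lt hij).eq_or_lt with h' | h'
  · rw [← h']
    exact ha i
  · exact (hlt h').1 (ha i)

/-- Induction on `n`, and for fixed `n` Noetherian induction on `U`: in `complSeries_eq` one term
has fewer variables, and the other belongs to a set containing `U`. -/
theorem exists_complSeries_mul_eq (n : ℕ) (U : Set (Fin n → ℕ)) (hU : IsUpperSet U) :
    ∃ p : Polynomial ℚ, complSeries U * (1 - PowerSeries.X : PowerSeries ℚ) ^ n = p := by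
  induction n with
  | zero =>
    refine ⟨Polynomial.C ((complDegree U 0).ncard : ℚ), ?_⟩
    ext k
    cases k with
    | zero => simp [complSeries]
    | succ k =>
      have : complDegree U (k + 1) = ∅ := by
        ext a
        simp [complDegree]
      simp [complSeries, this]
  | succ n ih =>
    refine wellFounded_isUpperSet.induction (C := fun U : {U : Set (Fin (n + 1) → ℕ) //
      IsUpperSet U} => ∃ p : Polynomial ℚ, complSeries U.1 * (1 - PowerSeries.X : PowerSeries ℚ) ^ (n + 1) = p)
      ⟨U, hU⟩ ?_
    rintro ⟨U, hU⟩ hind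
    have hU0 : IsUpperSet (consZero ⁻¹' U : Set (Fin n → ℕ)) := by
      intro a b hab ha
      exact hU ((Fin.cons_le_cons (α := fun _ => ℕ)).2 ⟨le_rfl, hab⟩) ha
    have hU1 : IsUpperSet ((· + Pi.single 0 1) ⁻¹' U : Set (Fin (n + 1) → ℕ)) := by
      intro a b hab ha
      exact hU (add_le_add_left hab _) ha
    have hsub : U ⊆ ((· + Pi.single 0 1) ⁻¹' U : Set (Fin (n + 1) → ℕ)) := by
      intro a ha
      exact hU (by simp) ha
    obtain ⟨p, hp⟩ := ih _ hU0
    have hrec := complSeries_eq U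
    rcases hsub.eq_or_ssubset with h | h
    -- If the shift does not enlarge `U`, the recursion reads `(1 - X) H_U = H_{U₀}`.
    · rw [← h] at hrec
      refine ⟨p, ?_⟩
      rw [← hp, pow_succ]
      linear_combination (1 - PowerSeries.X : PowerSeries ℚ) ^ n * hrec
    · obtain ⟨q, hq⟩ := hind ⟨_, hU1⟩ h
      refine ⟨p * (1 - Polynomial.X) + Polynomial.X * q, ?_⟩
      simp only [Polynomial.coe_add, Polynomial.coe_mul, Polynomial.coe_sub, Polynomial.coe_one,
        Polynomial.coe_X]
      rw [← hp, ← hq]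
      linear_combination (1 - PowerSeries.X : PowerSeries ℚ) ^ (n + 1) * hrec

end Counting

/-! ### Standard monomials -/

section Standard

/-- Greedy choice of a basis. Both claims are proved together because adding a new maximum keeps
independence only if the vectors chosen so far span all earlier ones. -/
theorem linearIndepOn_notMem_span {K M ι : Type*} [Field K] [AddCommGroup M] [Module K M]
    [LinearOrder ι] (v : ι → M) (s : Finset ι) :
    LinearIndepOn K v {i | i ∈ s ∧ v i ∉ Submodule.span K (v '' {j | j ∈ s ∧ j < i})} ∧
      Submodule.span K
        (v '' {i | i ∈ s ∧ v i ∉ Submodule.span K (v '' {j | j ∈ s ∧ j < i})}) =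
      Submodule.span K (v '' s) := by
  induction s using Finset.induction_on_max with
  | empty => simp
  | insert m s hm ih =>
    have hms : m ∉ s := fun h => lt_irrefl m (hm m h)
    have hbelow : ∀ i ∈ s, {j | j ∈ insert m s ∧ j < i} = {j | j ∈ s ∧ j < i} := by
      intro i hi
      ext j
      simp only [Finset.mem_insert, Set.mem_ofPred_eq]
      constructor
      · rintro ⟨rfl | h, h'⟩
        · exact absurd h' (hm i hi).not_gt
        · exact ⟨h, h'⟩
      · rintro ⟨h, h'⟩
        exact ⟨Or.inr h, h'⟩
    have hbelow' : {j | j ∈ insert m s ∧ j < m} = (s : Set ι) := by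
      ext j
      simp only [Finset.mem_insert, Set.mem_ofPred_eq, Finset.mem_coe]
      constructor
      · rintro ⟨rfl | h, h'⟩
        · exact absurd h' (lt_irrefl _)
        · exact h
      · intro h
        exact ⟨Or.inr h, hm j h⟩
    by_cases hv : v m ∈ Submodule.span K (v '' s)
    · have hset : {i | i ∈ insert m s ∧
          v i ∉ Submodule.span K (v '' {j | j ∈ insert m s ∧ j < i})} =
          {i | i ∈ s ∧ v i ∉ Submodule.span K (v '' {j | j ∈ s ∧ j < i})} := by
        ext i
        constructor
        · rintro ⟨hi, hi'⟩
          rcases Finset.mem_insert.1 hi with rfl | hi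
          · rw [hbelow'] at hi'
            exact absurd hv hi'
          · rw [hbelow i hi] at hi'
            exact ⟨hi, hi'⟩
        · rintro ⟨hi, hi'⟩
          refine ⟨Finset.mem_insert_of_mem hi, ?_⟩
          rwa [hbelow i hi]
      rw [hset]
      refine ⟨ih.1, ih.2.trans ?_⟩
      rw [Finset.coe_insert, Set.image_insert_eq, Submodule.span_insert_eq_span hv]
    · have hset : {i | i ∈ insert m s ∧
          v i ∉ Submodule.span K (v '' {j | j ∈ insert m s ∧ j < i})} =
          insert m {i | i ∈ s ∧ v i ∉ Submodule.span K (v '' {j | j ∈ s ∧ j < i})} := by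
        ext i
        constructor
        · rintro ⟨hi, hi'⟩
          rcases Finset.mem_insert.1 hi with rfl | hi
          · exact Set.mem_insert _ _
          · rw [hbelow i hi] at hi'
            exact Set.mem_insert_of_mem _ ⟨hi, hi'⟩
        · rintro (rfl | ⟨hi, hi'⟩)
          · refine ⟨Finset.mem_insert_self _ _, ?_⟩
            rwa [hbelow']
          · refine ⟨Finset.mem_insert_of_mem hi, ?_⟩
            rwa [hbelow i hi]
      rw [hset]
      refine ⟨ih.1.insert (by rwa [ih.2]), ?_⟩
      rw [Finset.coe_insert, Set.image_insert_eq, Set.image_insert_eq, Submodule.span_insert,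
        Submodule.span_insert, ih.2]

theorem finrank_span_image_eq_ncard {K M ι : Type*} [Field K] [AddCommGroup M] [Module K M]
    [LinearOrder ι] (v : ι → M) (s : Finset ι) :
    Module.finrank K (Submodule.span K (v '' s)) =
      {i | i ∈ s ∧ v i ∉ Submodule.span K (v '' {j | j ∈ s ∧ j < i})}.ncard := by
  obtain ⟨h1, h2⟩ := linearIndepOn_notMem_span (K := K) v s
  have hfin : {i | i ∈ s ∧ v i ∉ Submodule.span K (v '' {j | j ∈ s ∧ j < i})}.Finite :=
    s.finite_toSet.subset fun i hi => hi.1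
  have := hfin.fintype
  rw [← h2, Set.image_eq_range, finrank_span_eq_card h1, ← Nat.card_coe_set_eq,
    Nat.card_eq_fintype_card]

/-- The Hilbert series of an algebra generated by finitely many elements `x i`, graded by the spans
of the monomials of given degree, is a rational function. -/
theorem exists_series_mul_eq {K R : Type*} [Field K] [CommRing R] [Algebra K R] {n : ℕ}
    (x : Fin n → R) :
    ∃ p : Polynomial ℚ, (PowerSeries.mk fun k => (Module.finrank K (Submodule.span K
      ((fun a : Fin n → ℕ => ∏ i, x i ^ a i) '' {a | ∑ i, a i = k})) : ℚ)) *
        (1 - PowerSeries.X : PowerSeries ℚ) ^ n = p := by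
  classical
  let v : Lex (Fin n → ℕ) → R := fun a => ∏ i, x i ^ (ofLex a) i
  let deg : Lex (Fin n → ℕ) → ℕ := fun a => ∑ i, (ofLex a) i
  -- The leading exponents of homogeneous relations among the `x i`. Multiplying a relation by a
  -- monomial respects degree and lexicographic order, so `U` is an upper set; its complement
  -- indexes the greedy basis in each degree.
  let U : Set (Fin n → ℕ) :=
    {a | v (toLex a) ∈ Submodule.span K (v '' {b | deg b = deg (toLex a) ∧ b < toLex a})}
  have hv : ∀ a b, v (a + b) = v a * v b := by
    intro a b
    simp only [v]
    rw [← Finset.prod_mul_distrib]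
    exact Finset.prod_congr rfl fun i _ => pow_add _ _ _
  have hdeg : ∀ a b, deg (a + b) = deg a + deg b := by
    intro a b
    exact Finset.sum_add_distrib
  have hU : IsUpperSet U := by
    intro a b hab ha
    obtain ⟨c, rfl⟩ := exists_add_of_le hab
    have ha' : v (toLex a) ∈ Submodule.span K
        (v '' {b | deg b = deg (toLex a) ∧ b < toLex a}) := ha
    have h1 := Submodule.mem_map_of_mem (f := LinearMap.mulLeft K (v (toLex c))) ha'
    rw [Submodule.map_span] at h1
    change v (toLex a + toLex c) ∈ Submodule.span K (v '' {b | deg b = deg (toLex a + toLex c) ∧ b < toLex a + toLex c})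
    rw [hv, mul_comm]
    refine Submodule.span_mono ?_ h1
    rintro _ ⟨_, ⟨d, ⟨hd1, hd2⟩, rfl⟩, rfl⟩
    refine ⟨d + toLex c, ⟨?_, ?_⟩, ?_⟩
    · rw [hdeg, hd1, ← hdeg]
    · exact add_lt_add_left hd2 (toLex c)
    · rw [hv, mul_comm]
      rfl
  obtain ⟨p, hp⟩ := exists_complSeries_mul_eq n U hU
  refine ⟨p, ?_⟩
  rw [← hp]
  congr 1
  ext k
  simp only [complSeries, PowerSeries.coeff_mk]
  congr 1
  let s : Finset (Lex (Fin n → ℕ)) := (finite_sum_eq (σ := Fin n) k).toFinset.map toLex.toEmbedding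
  have hs : ∀ a, a ∈ s ↔ deg a = k := by
    intro a
    simp [s, deg]
  have hbelow : ∀ a ∈ s, {b | deg b = deg a ∧ b < a} = {b | b ∈ s ∧ b < a} := by
    intro a ha
    simp only [hs, (hs a).1 ha]
  have himage : ((fun a : Fin n → ℕ => ∏ i, x i ^ a i) '' {a | ∑ i, a i = k}) = v '' s := by
    ext y
    constructor
    · rintro ⟨a, ha, rfl⟩
      exact ⟨toLex a, (hs _).2 ha, rfl⟩
    · rintro ⟨a, ha, rfl⟩
      exact ⟨ofLex a, (hs _).1 ha, rfl⟩
  rw [himage, finrank_span_image_eq_ncard]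
  refine (congrArg Set.ncard (?_ : _ = toLex '' complDegree U k)).trans
    (Set.ncard_image_of_injective _ toLex.injective)
  · ext a
    constructor
    · rintro ⟨h1, h2⟩
      refine ⟨ofLex a, ⟨fun h => h2 ?_, (hs a).1 h1⟩, rfl⟩
      exact (congrArg (fun T => v a ∈ Submodule.span K (v '' T)) (hbelow a h1)).mp h
    · rintro ⟨b, ⟨h1, h2⟩, rfl⟩
      refine ⟨(hs _).2 h2, fun h => h1 ?_⟩
      exact (congrArg (fun T => v (toLex b) ∈ Submodule.span K (v '' T))
        (hbelow _ ((hs _).2 h2))).mpr h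

end Standard

/-! ### Hilbert functions of sets of vectors -/

section Pieces

variable {σ τ : Type*} [Fintype σ] [Fintype τ]

/-- The monomial with exponent `μ` as a function on `A`. -/
def monomialOn (A : Set (σ → ℂ)) (μ : σ → ℕ) : A → ℂ := fun a => ∏ s, a.1 s ^ μ s

/-- The functions on `A` given by forms of degree `k`. -/
def piece (A : Set (σ → ℂ)) (k : ℕ) : Submodule ℂ (A → ℂ) :=
  Submodule.span ℂ (monomialOn A '' {μ | ∑ s, μ s = k})

/-- The dimension of the space of functions on `A` given by forms of degree `k`. -/
def hilb (A : Set (σ → ℂ)) (k : ℕ) : ℕ := Module.finrank ℂ (piece A k)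

/-- The generating series of `hilb A`. -/
def hilbSeries (A : Set (σ → ℂ)) : PowerSeries ℚ := PowerSeries.mk fun k => (hilb A k : ℚ)

instance (A : Set (σ → ℂ)) (k : ℕ) : FiniteDimensional ℂ (piece A k) :=
  FiniteDimensional.span_of_finite ℂ ((finite_sum_eq k).image _)

theorem monomialOn_mem_piece (A : Set (σ → ℂ)) (μ : σ → ℕ) :
    monomialOn A μ ∈ piece A (∑ s, μ s) :=
  Submodule.subset_span ⟨μ, rfl, rfl⟩

/-- Restriction of polynomials to functions on `A`. -/
def restrictTo (A : Set (σ → ℂ)) : MvPolynomial σ ℂ →ₐ[ℂ] (A → ℂ) :=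
  MvPolynomial.aeval fun s a => a.1 s

omit [Fintype σ] in
theorem restrictTo_apply (A : Set (σ → ℂ)) (f : MvPolynomial σ ℂ) (a : A) :
    restrictTo A f a = MvPolynomial.eval a.1 f := by
  have : (Pi.evalAlgHom ℂ (fun _ : A => ℂ) a).comp (restrictTo A) = MvPolynomial.aeval a.1 := by
    ext s
    simp [restrictTo]
  exact DFunLike.congr_fun this f

theorem piece_eq_map (A : Set (σ → ℂ)) (k : ℕ) :
    piece A k = (MvPolynomial.homogeneousSubmodule σ ℂ k).map (restrictTo A).toLinearMap := by
  rw [MvPolynomial.homogeneousSubmodule_eq_finsupp_supported,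
    AddMonoidAlgebra.supported_eq_span_single, Submodule.map_span, piece, Set.image_image]
  congr 1
  have h : ∀ μ : σ →₀ ℕ, restrictTo A (MvPolynomial.monomial μ 1) = monomialOn A μ := by
    intro μ
    ext a
    rw [restrictTo_apply, MvPolynomial.eval_monomial, one_mul, Finsupp.prod_fintype]
    · rfl
    · simp
  ext g
  constructor
  · rintro ⟨μ, hμ, rfl⟩
    refine ⟨Finsupp.equivFunOnFinite.symm μ, ?_, ?_⟩
    · simpa [Finsupp.degree_eq_sum] using hμ
    · exact h _
  · rintro ⟨μ, hμ, rfl⟩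
    refine ⟨μ, ?_, (h μ).symm⟩
    simpa [Finsupp.degree_eq_sum] using hμ

theorem finrank_map_congr {K M N P : Type*} [Field K] [AddCommGroup M] [Module K M]
    [AddCommGroup N] [Module K N] [AddCommGroup P] [Module K P] (W : Submodule K M)
    (f : M →ₗ[K] N) (g : M →ₗ[K] P) (h : ∀ w ∈ W, f w = 0 ↔ g w = 0) :
    Module.finrank K (W.map f) = Module.finrank K (W.map g) := by
  have hker : LinearMap.ker (f.domRestrict W) = LinearMap.ker (g.domRestrict W) := by
    ext w
    exact h w.1 w.2
  rw [← LinearMap.range_domRestrict, ← LinearMap.range_domRestrict]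
  exact ((f.domRestrict W).quotKerEquivRange.symm.trans
    ((Submodule.quotEquivOfEq _ _ hker).trans (g.domRestrict W).quotKerEquivRange)).finrank_eq

/-- Only the forms vanishing on a set matter. This allows passing to Zariski closures, choosing
representatives and discarding limit points. -/
theorem hilb_congr (A B : Set (σ → ℂ)) (h : ∀ (k : ℕ) (f : MvPolynomial σ ℂ), f.IsHomogeneous k →
    ((∀ a ∈ A, MvPolynomial.eval a f = 0) ↔ ∀ b ∈ B, MvPolynomial.eval b f = 0)) :
    hilb A = hilb B := by
  funext k
  rw [hilb, hilb, piece_eq_map, piece_eq_map]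
  refine finrank_map_congr _ _ _ fun f hf => ?_
  simpa [funext_iff, restrictTo_apply] using h k f hf

theorem hilbertFunction_eq_hilb (Z : Set (ℙ ℂ (σ → ℂ))) : hilbertFunction Z = hilb (cone Z) := by
  funext k
  rw [hilb, piece_eq_map, hilbertFunction]
  refine finrank_map_congr _ _ _ fun f _ => ?_
  have h1 : (Ideal.Quotient.mkₐ ℂ (projIdeal Z)).toLinearMap f = 0 ↔ f ∈ projIdeal Z :=
    Ideal.Quotient.eq_zero_iff_mem
  rw [h1, projIdeal, MvPolynomial.mem_vanishingIdeal_iff]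
  simp only [AlgHom.toLinearMap_apply, funext_iff, restrictTo_apply, Subtype.forall,
    Pi.zero_apply]
  rfl

theorem hilb_reindex (e : σ ≃ τ) (A : Set (σ → ℂ)) (B : Set (τ → ℂ))
    (h : ∀ v, v ∈ B ↔ v ∘ e ∈ A) : hilb A = hilb B := by
  funext k
  let E : B ≃ A := (Equiv.arrowCongr e (Equiv.refl ℂ)).symm.subtypeEquiv h
  have hE : ∀ μ, (monomialOn A μ) ∘ E = monomialOn B (μ ∘ e.symm) := by
    intro μ
    funext b
    refine Fintype.prod_equiv e _ _ fun s => ?_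
    simp [E, Equiv.arrowCongr]
  have : piece B k = (piece A k).map (LinearEquiv.funCongrLeft ℂ ℂ E : (A → ℂ) →ₗ[ℂ] (B → ℂ)) := by
    rw [piece, piece, Submodule.map_span, Set.image_image]
    congr 1
    ext g
    constructor
    · rintro ⟨μ, hμ, rfl⟩
      refine ⟨μ ∘ e, ?_, ?_⟩
      · rw [Set.mem_ofPred_eq] at hμ ⊢
        rw [← hμ]
        exact Fintype.sum_equiv e _ _ fun _ => rfl
      · refine (hE _).trans ?_
        rw [Function.comp_assoc]
        simp
    · rintro ⟨μ, hμ, rfl⟩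
      refine ⟨μ ∘ e.symm, ?_, (hE μ).symm⟩
      rw [Set.mem_ofPred_eq] at hμ ⊢
      rw [← hμ]
      exact Fintype.sum_equiv e.symm _ _ fun _ => rfl
  rw [hilb, hilb, this, LinearEquiv.finrank_map_eq]

theorem exists_hilbSeries_mul_eq (A : Set (σ → ℂ)) :
    ∃ (n : ℕ) (p : Polynomial ℚ), hilbSeries A * (1 - PowerSeries.X : PowerSeries ℚ) ^ n = p := by
  let e := Fintype.equivFin σ
  let B : Set (Fin (Fintype.card σ) → ℂ) := {v | v ∘ e ∈ A}
  obtain ⟨p, hp⟩ := exists_series_mul_eq (K := ℂ) (fun i (b : B) => b.1 i)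
  refine ⟨Fintype.card σ, p, ?_⟩
  rw [← hp, hilbSeries, hilb_reindex e A B fun _ => Iff.rfl]
  congr 3
  funext k
  rw [hilb, piece]
  have : monomialOn B = fun a : Fin (Fintype.card σ) → ℕ => ∏ i, (fun b : B => b.1 i) ^ a i := by
    funext a b
    simp [monomialOn]
  rw [this]

theorem hilb_pos (A : Set (σ → ℂ)) (v : σ → ℂ) (hv : v ∈ A) (hv0 : v ≠ 0) (k : ℕ) :
    0 < hilb A k := by
  classical
  obtain ⟨s, hs⟩ := Function.ne_iff.1 hv0
  have hmem := monomialOn_mem_piece A (Pi.single s k)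
  rw [show ∑ i, (Pi.single s k : σ → ℕ) i = k by simp] at hmem
  have : Nontrivial (piece A k) := by
    refine ⟨⟨⟨_, hmem⟩, 0, fun h => ?_⟩⟩
    have h1 := congrFun (congrArg Subtype.val h) ⟨v, hv⟩
    change ∏ i, v i ^ (Pi.single s k : σ → ℕ) i = 0 at h1
    rw [Finset.prod_eq_zero_iff] at h1
    obtain ⟨i, -, hi⟩ := h1
    rcases eq_or_ne i s with rfl | his
    · exact hs (eq_zero_of_pow_eq_zero hi)
    · simp [his] at hi
  exact Module.finrank_pos

end Pieces

/-! ### Degree and dimension from the Hilbert series -/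

section Degree

variable {σ τ : Type*} [Fintype σ] [Fintype τ]

/-- The Hilbert series of `A` has a pole of order `d` at `1`, and `δ` is the value at `1` of its
product with `(1 - X) ^ d`. -/
def HasDegree (A : Set (σ → ℂ)) (d : ℕ) (δ : ℚ) : Prop :=
  ∃ p : Polynomial ℚ, hilbSeries A * (1 - PowerSeries.X : PowerSeries ℚ) ^ d = p ∧
    p.eval 1 = δ ∧ δ ≠ 0

theorem HasDegree.congr {A : Set (σ → ℂ)} {B : Set (τ → ℂ)} {d : ℕ} {δ : ℚ}
    (hA : HasDegree A d δ) (h : hilb A = hilb B) : HasDegree B d δ := by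
  rwa [HasDegree, hilbSeries, ← h]

/-- Cancel all factors `1 - X` from the numerator. A pole must remain: otherwise the series would be
a polynomial, while `hilb_pos` makes every coefficient nonzero. -/
theorem exists_hasDegree (A : Set (σ → ℂ)) (v : σ → ℂ) (hv : v ∈ A) (hv0 : v ≠ 0) :
    ∃ (d : ℕ) (δ : ℚ), HasDegree A (d + 1) δ := by
  obtain ⟨n, p, hp⟩ := exists_hilbSeries_mul_eq A
  have hX : (1 - PowerSeries.X : PowerSeries ℚ) ≠ 0 := by
    intro h
    simpa using congrArg PowerSeries.constantCoeff h
  have hcoeff : ∀ k, (hilbSeries A).coeff k ≠ 0 := by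
    intro k
    simpa [hilbSeries] using (hilb_pos A v hv hv0 k).ne'
  have hS : hilbSeries A ≠ 0 := fun h => hcoeff 0 (by simp [h])
  have hp0 : p ≠ 0 := by
    rintro rfl
    exact mul_ne_zero hS (pow_ne_zero _ hX) (by simpa using hp)
  obtain ⟨q, hq, hq1⟩ := p.exists_eq_pow_rootMultiplicity_mul_and_not_dvd hp0 1
  generalize p.rootMultiplicity 1 = m at hq
  -- Root multiplicity counts factors `X - 1`; the sign is absorbed into the cofactor.
  have hp' : p = (1 - Polynomial.X) ^ m * ((-1) ^ m * q) := by
    rw [hq, Polynomial.C_1, ← neg_sub, neg_pow]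
    ring
  have hpS : (p : PowerSeries ℚ) = (1 - PowerSeries.X) ^ m *
      (((-1) ^ m * q : Polynomial ℚ) : PowerSeries ℚ) := by
    conv_lhs => rw [hp']
    simp
  have hr1 : ((-1) ^ m * q : Polynomial ℚ).eval 1 ≠ 0 := by
    rw [Polynomial.dvd_iff_isRoot] at hq1
    simpa using hq1
  generalize ((-1) ^ m * q : Polynomial ℚ) = r at hpS hr1
  rcases lt_or_ge m n with h | h
  · obtain ⟨d, rfl⟩ := Nat.exists_eq_add_of_lt h
    refine ⟨d, _, r, ?_, rfl, hr1⟩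
    apply mul_left_cancel₀ (pow_ne_zero m hX)
    rw [← hpS, ← hp]
    ring
  · obtain ⟨j, rfl⟩ := Nat.exists_eq_add_of_le h
    exfalso
    have hpoly : hilbSeries A = (((1 - Polynomial.X) ^ j * r : Polynomial ℚ) : PowerSeries ℚ) := by
      apply mul_left_cancel₀ (pow_ne_zero n hX)
      rw [mul_comm, hp, hpS]
      simp
      ring
    apply hcoeff (((1 - Polynomial.X) ^ j * r : Polynomial ℚ).natDegree + 1)
    rw [hpoly, Polynomial.coeff_coe]
    exact Polynomial.coeff_eq_zero_of_natDegree_lt (Nat.lt_succ_self _)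

/-- The coefficients of `p / (1 - X)^(d+1)` eventually agree with a polynomial, of degree exactly
`d` because `p(1) ≠ 0`, with leading coefficient `p(1) / d!`. -/
theorem projDegree_eq_of_hasDegree (Z : Set (ℙ ℂ (σ → ℂ))) (d : ℕ) (δ : ℚ)
    (h : HasDegree (cone Z) (d + 1) δ) : projDegree Z = δ := by
  obtain ⟨p, hp, rfl, hδ⟩ := h
  have hS : hilbSeries (cone Z) = p * PowerSeries.invOneSubPow ℚ (d + 1) := by
    rw [← hp, mul_assoc, ← PowerSeries.invOneSubPow_inv_eq_one_sub_pow, Units.inv_eq_val_inv,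
      Units.inv_mul, mul_one]
  have hP : hilbertPolynomial Z = p.hilbertPoly (d + 1) := by
    refine hilbertPolynomial_eq Z _ ?_
    filter_upwards [Filter.eventually_gt_atTop p.natDegree] with k hk
    rw [← Polynomial.coeff_mul_invOneSubPow_eq_hilbertPoly_eval _ hk, ← hS, hilbSeries,
      PowerSeries.coeff_mk, hilbertFunction_eq_hilb]
  have hp0 : p ≠ 0 := by
    rintro rfl
    simp at hδ
  have hroot : p.rootMultiplicity 1 = 0 := Polynomial.rootMultiplicity_eq_zero hδ
  have hdeg : (p.hilbertPoly (d + 1)).natDegree = d := by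
    rw [Polynomial.natDegree_hilbertPoly_of_ne_zero_of_rootMultiplicity_lt hp0 (by omega), hroot]
    rfl
  rw [projDegree, hP, Polynomial.leadingCoeff, hdeg, Polynomial.hilbertPoly_succ]
  -- Each coefficient of `p` contributes itself times `1 / d!` in degree `d`, so the sum is `p(1) /
  -- d!`.
  simp only [Polynomial.finsetSum_coeff, Polynomial.coeff_smul, smul_eq_mul,
    Polynomial.coeff_preHilbertPoly_self, ← Finset.sum_mul]
  rw [mul_comm, mul_assoc, inv_mul_cancel₀ (by exact_mod_cast d.factorial_ne_zero), mul_one,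
    Polynomial.eval_eq_sum, Polynomial.sum]
  simp

end Degree

/-! ### Products of cones -/

section Products

variable {σ τ : Type*} [Fintype σ] [Fintype τ]

/-- A set of vectors that is stable under nonzero scalars. -/
def ScaleStable {σ : Type*} (A : Set (σ → ℂ)) : Prop := ∀ c : ℂ, c ≠ 0 → ∀ v ∈ A, c • v ∈ A

/-- The product of two sets of vectors. -/
def prodSet {σ τ : Type*} (A : Set (σ → ℂ)) (B : Set (τ → ℂ)) : Set (σ ⊕ τ → ℂ) :=
  {v | v ∘ Sum.inl ∈ A ∧ v ∘ Sum.inr ∈ B}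

/-- Forms of degree `k` are eigenvectors, with eigenvalue `2^k`, of the operator `f ↦ f(2 ·)`, and
these eigenvalues are distinct. -/
theorem ScaleStable.iSupIndep_piece {A : Set (σ → ℂ)} (hA : ScaleStable A) :
    iSupIndep (piece A) := by
  let E : A → A := fun a => ⟨(2 : ℂ) • a.1, hA 2 two_ne_zero a.1 a.2⟩
  let T : Module.End ℂ (A → ℂ) := LinearMap.funLeft ℂ ℂ E
  have hinj : Function.Injective fun k : ℕ => (2 : ℂ) ^ k := by
    intro i j hij
    have h2 : ((2 ^ i : ℕ) : ℂ) = ((2 ^ j : ℕ) : ℂ) := by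
      push_cast
      exact hij
    exact Nat.pow_right_injective le_rfl (Nat.cast_injective h2)
  refine (T.eigenspaces_iSupIndep.comp hinj).mono fun k => ?_
  rw [piece, Submodule.span_le]
  rintro _ ⟨μ, hμ, rfl⟩
  rw [SetLike.mem_coe, Function.comp_apply, Module.End.mem_eigenspace_iff]
  funext a
  rw [Set.mem_ofPred_eq] at hμ
  simp [T, E, monomialOn, mul_pow, Finset.prod_mul_distrib, Finset.prod_pow_eq_pow_sum, hμ]

/-- Bases of all the pieces, put together. -/
def pieceBasis (A : Set (σ → ℂ)) (i : Σ k : ℕ, Fin (hilb A k)) : A → ℂ :=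
  (Module.finBasis ℂ (piece A i.1) i.2 : A → ℂ)

theorem span_range_pieceBasis (A : Set (σ → ℂ)) (k : ℕ) :
    Submodule.span ℂ (Set.range fun α => pieceBasis A ⟨k, α⟩) = piece A k := by
  have := congrArg (Submodule.map (piece A k).subtype) (Module.finBasis ℂ (piece A k)).span_eq
  rw [Submodule.map_span, ← Set.range_comp, Submodule.map_subtype_top] at this
  exact this

theorem ScaleStable.linearIndependent_pieceBasis {A : Set (σ → ℂ)} (hA : ScaleStable A) :
    LinearIndependent ℂ (pieceBasis A) := by
  refine linearIndependent_iUnion_finite (f := fun k α => pieceBasis A ⟨k, α⟩) (fun k => ?_)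
    fun i t _ hit => ?_
  · exact (Module.finBasis ℂ (piece A k)).linearIndependent.map' (piece A k).subtype
      (Submodule.ker_subtype _)
  · simp only [span_range_pieceBasis]
    have h : Disjoint (piece A i) (⨆ j, ⨆ _ : j ≠ i, piece A j) := hA.iSupIndep_piece i
    refine h.mono_right (iSup₂_le fun j hj => ?_)
    have hji : j ≠ i := by
      rintro rfl
      exact hit hj
    exact le_iSup₂ (f := fun j (_ : j ≠ i) => piece A j) j hji

/-- Freeze `x` and use independence of `g` in the variable `y`; the resulting coefficients are
relations among the `f i`. The hypothesis `hπ` lets `x` and `y` vary independently. -/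
theorem linearIndependent_mul_comp {K X Y P ι κ : Type*} [Field K] {f : ι → X → K}
    {g : κ → Y → K} (hf : LinearIndependent K f) (hg : LinearIndependent K g) (π₁ : P → X)
    (π₂ : P → Y) (hπ : ∀ x y, ∃ p, π₁ p = x ∧ π₂ p = y) :
    LinearIndependent K fun i : ι × κ => (f i.1 ∘ π₁) * (g i.2 ∘ π₂) := by
  classical
  rw [linearIndependent_iff'']
  intro s c hc h0 ij
  by_contra hne
  have hij : ij ∈ s := by
    by_contra h
    exact hne (hc ij h)
  have hsub : s ⊆ s.image Prod.fst ×ˢ s.image Prod.snd := fun x hx =>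
    Finset.mem_product.2 ⟨Finset.mem_image_of_mem _ hx, Finset.mem_image_of_mem _ hx⟩
  rw [Finset.sum_subset hsub fun x _ hx => by rw [hc x hx, zero_smul],
    Finset.sum_product_right] at h0
  have h1 : ∀ x, ∑ j ∈ s.image Prod.snd, (∑ i ∈ s.image Prod.fst, c (i, j) * f i x) • g j = 0 := by
    intro x
    funext y
    obtain ⟨p, rfl, rfl⟩ := hπ x y
    have := congrFun h0 p
    simpa [Finset.sum_apply, Finset.sum_mul, mul_assoc] using this
  have h2 : ∑ i ∈ s.image Prod.fst, c (i, ij.2) • f i = 0 := by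
    funext x
    simpa using linearIndependent_iff'.1 hg _ _ (h1 x) ij.2 (Finset.mem_image_of_mem _ hij)
  exact hne (linearIndependent_iff'.1 hf _ _ h2 ij.1 (Finset.mem_image_of_mem _ hij))

/-- The first projection of a product. -/
def prodSetFst (A : Set (σ → ℂ)) (B : Set (τ → ℂ)) (v : prodSet A B) : A := ⟨_, v.2.1⟩

/-- The second projection of a product. -/
def prodSetSnd (A : Set (σ → ℂ)) (B : Set (τ → ℂ)) (v : prodSet A B) : B := ⟨_, v.2.2⟩

theorem monomialOn_prodSet (A : Set (σ → ℂ)) (B : Set (τ → ℂ)) (μ : σ ⊕ τ → ℕ) :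
    monomialOn (prodSet A B) μ = (monomialOn A (μ ∘ Sum.inl) ∘ prodSetFst A B) *
      (monomialOn B (μ ∘ Sum.inr) ∘ prodSetSnd A B) := by
  funext v
  exact Fintype.prod_sum_type _

theorem mul_comp_mem_piece {A : Set (σ → ℂ)} {B : Set (τ → ℂ)} {i j : ℕ} {f : A → ℂ} {g : B → ℂ}
    (hf : f ∈ piece A i) (hg : g ∈ piece B j) :
    (f ∘ prodSetFst A B) * (g ∘ prodSetSnd A B) ∈ piece (prodSet A B) (i + j) := by
  induction hf using Submodule.span_induction with
  | mem f hf =>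
    obtain ⟨μ, hμ, rfl⟩ := hf
    induction hg using Submodule.span_induction with
    | mem g hg =>
      obtain ⟨ν, hν, rfl⟩ := hg
      refine Submodule.subset_span ⟨Sum.elim μ ν, ?_, monomialOn_prodSet A B (Sum.elim μ ν)⟩
      rw [Set.mem_ofPred_eq] at hμ hν ⊢
      rw [Fintype.sum_sum_type, ← hμ, ← hν]
      rfl
    | zero => simp [Pi.zero_comp]
    | add g g' _ _ h h' =>
      rw [Pi.add_comp, mul_add]
      exact Submodule.add_mem _ h h'
    | smul c g _ h =>
      rw [Pi.smul_comp, mul_smul_comm]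
      exact Submodule.smul_mem _ c h
  | zero => simp [Pi.zero_comp]
  | add f f' _ _ h h' =>
    rw [Pi.add_comp, add_mul]
    exact Submodule.add_mem _ h h'
  | smul c f _ h =>
    rw [Pi.smul_comp, smul_mul_assoc]
    exact Submodule.smul_mem _ c h

/-- Products of basis functions of degrees `i` and `j` with `i + j = k` span the degree `k` piece.
They are independent across all bidegrees because scale stability makes the pieces of each factor
independent. -/
theorem hilb_prodSet {A : Set (σ → ℂ)} {B : Set (τ → ℂ)} (hA : ScaleStable A)
    (hB : ScaleStable B) (k : ℕ) :
    hilb (prodSet A B) k = ∑ ij ∈ Finset.HasAntidiagonal.antidiagonal k, hilb A ij.1 * hilb B ij.2 := by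
  classical
  let F : (Σ k, Fin (hilb A k)) × (Σ k, Fin (hilb B k)) → prodSet A B → ℂ := fun i =>
    (pieceBasis A i.1 ∘ prodSetFst A B) * (pieceBasis B i.2 ∘ prodSetSnd A B)
  have hF : LinearIndependent ℂ F :=
    linearIndependent_mul_comp hA.linearIndependent_pieceBasis hB.linearIndependent_pieceBasis _ _
      fun x y => ⟨⟨Sum.elim x.1 y.1, x.2, y.2⟩, rfl, rfl⟩
  let J := Σ ij : Finset.HasAntidiagonal.antidiagonal k, Fin (hilb A ij.1.1) × Fin (hilb B ij.1.2)
  let ρ : J → (Σ k, Fin (hilb A k)) × (Σ k, Fin (hilb B k)) :=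
    fun t => (⟨t.1.1.1, t.2.1⟩, ⟨t.1.1.2, t.2.2⟩)
  have hρ : Function.Injective ρ := by
    rintro ⟨⟨⟨i, j⟩, hij⟩, α, β⟩ ⟨⟨⟨i', j'⟩, hij'⟩, α', β'⟩ h
    simp only [ρ, Prod.mk.injEq, Sigma.mk.injEq] at h
    obtain ⟨⟨rfl, h1⟩, rfl, h2⟩ := h
    cases h1
    cases h2
    rfl
  have hspan : Submodule.span ℂ (Set.range (F ∘ ρ)) = piece (prodSet A B) k := by
    refine le_antisymm ?_ ?_
    · rw [Submodule.span_le]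
      rintro _ ⟨⟨⟨⟨i, j⟩, hij⟩, α, β⟩, rfl⟩
      have h : pieceBasis A ⟨i, α⟩ ∘ prodSetFst A B * pieceBasis B ⟨j, β⟩ ∘ prodSetSnd A B ∈
          piece (prodSet A B) (i + j) := mul_comp_mem_piece (Subtype.prop _) (Subtype.prop _)
      rwa [Finset.HasAntidiagonal.mem_antidiagonal.1 hij] at h
    · rw [piece, Submodule.span_le]
      rintro _ ⟨μ, hμ, rfl⟩
      rw [Set.mem_ofPred_eq, Fintype.sum_sum_type] at hμ
      have hf := monomialOn_mem_piece A (μ ∘ Sum.inl)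
      have hg := monomialOn_mem_piece B (μ ∘ Sum.inr)
      have hij : (∑ s, (μ ∘ Sum.inl) s, ∑ s, (μ ∘ Sum.inr) s) ∈ Finset.HasAntidiagonal.antidiagonal k :=
        Finset.HasAntidiagonal.mem_antidiagonal.2 hμ
      generalize ∑ s, (μ ∘ Sum.inl) s = i at hf hij
      generalize ∑ s, (μ ∘ Sum.inr) s = j at hg hij
      rw [← span_range_pieceBasis] at hf hg
      have hf' := Submodule.mem_map_of_mem (f := LinearMap.funLeft ℂ ℂ (prodSetFst A B)) hf
      have hg' := Submodule.mem_map_of_mem (f := LinearMap.funLeft ℂ ℂ (prodSetSnd A B)) hg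
      have hfg := Submodule.mul_mem_mul hf' hg'
      rw [Submodule.map_span, Submodule.map_span, Submodule.span_mul_span] at hfg
      rw [SetLike.mem_coe, monomialOn_prodSet]
      refine Submodule.span_mono ?_ hfg
      rintro _ ⟨_, ⟨_, ⟨α, rfl⟩, rfl⟩, _, ⟨_, ⟨β, rfl⟩, rfl⟩, rfl⟩
      exact ⟨⟨⟨(i, j), hij⟩, α, β⟩, rfl⟩
  rw [hilb, ← hspan, finrank_span_eq_card (hF.comp ρ hρ), Fintype.card_sigma]
  simp only [Fintype.card_prod, Fintype.card_fin]
  exact Finset.sum_coe_sort (Finset.HasAntidiagonal.antidiagonal k) fun ij => hilb A ij.1 * hilb B ij.2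

theorem HasDegree.prodSet {A : Set (σ → ℂ)} {B : Set (τ → ℂ)} {d e : ℕ} {δ ε : ℚ}
    (hA : ScaleStable A) (hB : ScaleStable B) (hδ : HasDegree A d δ) (hε : HasDegree B e ε) :
    HasDegree (prodSet A B) (d + e) (δ * ε) := by
  obtain ⟨p, hp, rfl, hp0⟩ := hδ
  obtain ⟨q, hq, rfl, hq0⟩ := hε
  refine ⟨p * q, ?_, by simp, mul_ne_zero hp0 hq0⟩
  have : hilbSeries (GraphicalDegree.prodSet A B) = hilbSeries A * hilbSeries B := by
    ext k
    simp [hilbSeries, PowerSeries.coeff_mul, hilb_prodSet hA hB]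
  rw [this, Polynomial.coe_mul, ← hp, ← hq]
  ring

/-- The power of a set of vectors, with exponent the cardinality of `ι`. -/
def powSet {σ : Type*} (A : Set (σ → ℂ)) (ι : Type*) : Set (σ × ι → ℂ) :=
  {v | ∀ i, (fun s => v (s, i)) ∈ A}

omit [Fintype σ] in
theorem ScaleStable.powSet {A : Set (σ → ℂ)} (hA : ScaleStable A) (ι : Type*) :
    ScaleStable (powSet A ι) := fun c hc _ hv i => hA c hc _ (hv i)

/-- Splitting off the first factor of a power. -/
def prodFinSuccEquiv (σ : Type*) (N : ℕ) : σ ⊕ σ × Fin N ≃ σ × Fin (N + 1) where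
  toFun := Sum.elim (fun s => (s, 0)) fun x => (x.1, x.2.succ)
  invFun x := Fin.cases (Sum.inl x.1) (fun i => Sum.inr (x.1, i)) x.2
  left_inv := by rintro (s | ⟨s, i⟩) <;> rfl
  right_inv := by
    rintro ⟨s, i⟩
    cases i using Fin.cases <;> rfl

theorem HasDegree.powSet_fin {A : Set (σ → ℂ)} {d : ℕ} {δ : ℚ} (hA : ScaleStable A)
    (hδ : HasDegree A d δ) (N : ℕ) :
    HasDegree (powSet A (Fin (N + 1))) ((N + 1) * d) (δ ^ (N + 1)) := by
  induction N with
  | zero =>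
    rw [zero_add, one_mul, pow_one]
    refine hδ.congr (hilb_reindex (Equiv.prodUnique σ (Fin 1)).symm A _ fun v => ?_)
    exact Fin.forall_fin_one
  | succ N ih =>
    rw [pow_succ', Nat.succ_mul, add_comm ((N + 1) * d)]
    refine (HasDegree.prodSet hA (hA.powSet _) hδ ih).congr
      (hilb_reindex (prodFinSuccEquiv σ (N + 1)) _ _ fun v => ?_)
    exact Fin.forall_fin_succ

end Products

/-! ### Cones over projective sets -/

section Cones

variable {σ τ : Type*}

theorem scaleStable_cone (Z : Set (ℙ ℂ (σ → ℂ))) : ScaleStable (cone Z) := by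
  rintro c hc v ⟨hv, hZ⟩
  refine ⟨smul_ne_zero hc hv, ?_⟩
  rwa [← (Projectivization.mk_eq_mk_iff' ℂ (c • v) v (smul_ne_zero hc hv) hv).2 ⟨c, rfl⟩] at hZ

theorem rep_mem_cone {Z : Set (ℙ ℂ (σ → ℂ))} {P : ℙ ℂ (σ → ℂ)} (hP : P ∈ Z) : P.rep ∈ cone Z :=
  ⟨P.rep_nonzero, by rwa [P.mk_rep]⟩

theorem eval_smul_of_isHomogeneous [Fintype σ] {f : MvPolynomial σ ℂ} {k : ℕ}
    (hf : f.IsHomogeneous k) (c : ℂ) (v : σ → ℂ) :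
    MvPolynomial.eval (c • v) f = c ^ k * MvPolynomial.eval v f := by
  rw [MvPolynomial.eval_eq', MvPolynomial.eval_eq', Finset.mul_sum]
  refine Finset.sum_congr rfl fun d hd => ?_
  have hk : ∑ i, d i = k := by
    rw [← Finsupp.degree_eq_sum, Finsupp.degree_eq_weight_one]
    exact hf (MvPolynomial.mem_support_iff.1 hd)
  simp only [Pi.smul_apply, smul_eq_mul, mul_pow, Finset.prod_mul_distrib,
    Finset.prod_pow_eq_pow_sum, hk]
  ring

theorem eval_rep_eq_zero_iff [Fintype σ] {f : MvPolynomial σ ℂ} {k : ℕ}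
    (hf : f.IsHomogeneous k) (v : σ → ℂ) (hv : v ≠ 0) :
    MvPolynomial.eval (Projectivization.mk ℂ v hv).rep f = 0 ↔ MvPolynomial.eval v f = 0 := by
  obtain ⟨a, ha⟩ := Projectivization.exists_smul_eq_mk_rep ℂ v hv
  rw [← ha, Units.smul_def, eval_smul_of_isHomogeneous hf]
  simp

theorem forall_cone_eval_eq_zero_iff [Fintype σ] {f : MvPolynomial σ ℂ} {k : ℕ}
    (hf : f.IsHomogeneous k) (Z : Set (ℙ ℂ (σ → ℂ))) :
    (∀ v ∈ cone Z, MvPolynomial.eval v f = 0) ↔ Z ⊆ projZeroLocus {f} := by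
  constructor
  · rintro h P hP g rfl
    exact h _ (rep_mem_cone hP)
  · rintro h v ⟨hv, hZ⟩
    exact (eval_rep_eq_zero_iff hf v hv).1 (h hZ f rfl)

theorem isClosed_zariski_iff (Z : Set (ℙ ℂ (σ → ℂ))) :
    IsClosed[zariski σ] Z ↔ IsProjAlgebraic Z := by
  rw [← @isOpen_compl_iff _ _ (zariski σ)]
  change IsProjAlgebraic Zᶜᶜ ↔ _
  rw [compl_compl]

/-- The zero locus of a form is Zariski closed, so it contains a set as soon as it contains a dense
part of it. -/
theorem hilb_cone_closure [Fintype σ] (T : Set (ℙ ℂ (σ → ℂ))) :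
    hilb (cone (@closure _ (zariski σ) T)) = hilb (cone T) := by
  refine hilb_congr _ _ fun k f hf => ?_
  rw [forall_cone_eval_eq_zero_iff hf, forall_cone_eval_eq_zero_iff hf]
  refine @IsClosed.closure_subset_iff _ (zariski σ) _ _ ((isClosed_zariski_iff _).2 ?_)
  exact ⟨{f}, by rintro g rfl; exact ⟨k, hf⟩, rfl⟩

theorem eval_eq_zero_of_punctured [Fintype σ] (f : MvPolynomial σ ℂ) (g : ℂ → σ → ℂ)
    (hg : Continuous g) (h : ∀ t, t ≠ 0 → MvPolynomial.eval (g t) f = 0) (t : ℂ) :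
    MvPolynomial.eval (g t) f = 0 := by
  have hcont : Continuous fun t => MvPolynomial.eval (g t) f := f.continuous_eval.comp hg
  have := Continuous.ext_on (dense_compl_singleton (0 : ℂ)) hcont continuous_const
    (fun t ht => h t ht)
  exact congrFun this t

/-- The cone over the join also has points with `a = 0` or `b = 0`, outside the product of the
cones. They are limits of points of the product in the usual topology, so forms vanishing on the
product vanish there; the two scalars are treated one at a time. -/
theorem hilb_cone_joinVariety [Fintype σ] [Fintype τ] (Y : Set (ℙ ℂ (σ → ℂ)))
    (Z : Set (ℙ ℂ (τ → ℂ))) :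
    hilb (cone (joinVariety Y Z)) = hilb (prodSet (cone Y) (cone Z)) := by
  refine hilb_congr _ _ fun k f hf => ⟨fun h v hv => ?_, fun h v hv => ?_⟩
  · have hv0 : v ≠ 0 := by
      rintro rfl
      exact hv.1.1 rfl
    have hv1 : Sum.elim ((1 : ℂ) • v ∘ Sum.inl) ((1 : ℂ) • v ∘ Sum.inr) = v := by
      rw [one_smul, one_smul, Sum.elim_comp_inl_inr]
    refine h v ⟨hv0, _, hv.1, _, hv.2, 1, 1, by rwa [hv1], ?_⟩
    congr 1
    exact hv1.symm
  · obtain ⟨hv0, y, hy, z, hz, a, b, hab, hmk⟩ := hv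
    rw [← eval_rep_eq_zero_iff hf v hv0, hmk, eval_rep_eq_zero_iff hf]
    have h1 : ∀ a b : ℂ, a ≠ 0 → b ≠ 0 → MvPolynomial.eval (Sum.elim (a • y) (b • z)) f = 0 :=
      fun a b ha hb => h _ ⟨scaleStable_cone Y a ha y hy, scaleStable_cone Z b hb z hz⟩
    have hcont : ∀ {g₁ : ℂ → σ → ℂ} {g₂ : ℂ → τ → ℂ}, Continuous g₁ → Continuous g₂ →
        Continuous fun t => Sum.elim (g₁ t) (g₂ t) := by
      intro g₁ g₂ h₁ h₂
      refine continuous_pi ?_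
      rintro (s | s)
      · exact (continuous_apply s).comp h₁
      · exact (continuous_apply s).comp h₂
    refine eval_eq_zero_of_punctured f (fun t => Sum.elim (t • y) (b • z))
      (hcont (by fun_prop) (by fun_prop)) (fun t ht => ?_) a
    exact eval_eq_zero_of_punctured f (fun u => Sum.elim (t • y) (u • z))
      (hcont (by fun_prop) (by fun_prop)) (fun u hu => h1 t u ht hu) b

theorem exists_hasDegree_cone [Fintype σ] (Z : Set (ℙ ℂ (σ → ℂ))) (hZ : Z.Nonempty) :
    ∃ (d : ℕ) (δ : ℚ), HasDegree (cone Z) (d + 1) δ := by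
  obtain ⟨P, hP⟩ := hZ
  exact exists_hasDegree _ _ (rep_mem_cone hP) P.rep_nonzero

theorem projDegree_joinVariety [Fintype σ] [Fintype τ] (Y : Set (ℙ ℂ (σ → ℂ)))
    (Z : Set (ℙ ℂ (τ → ℂ))) (hY : Y.Nonempty) (hZ : Z.Nonempty) :
    projDegree (joinVariety Y Z) = projDegree Y * projDegree Z := by
  obtain ⟨d, δ, hδ⟩ := exists_hasDegree_cone Y hY
  obtain ⟨e, ε, hε⟩ := exists_hasDegree_cone Z hZ
  rw [projDegree_eq_of_hasDegree Y d δ hδ, projDegree_eq_of_hasDegree Z e ε hε]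
  -- The pole orders `d + 1` and `e + 1` add up to `(d + 1 + e) + 1`.
  exact projDegree_eq_of_hasDegree _ (d + 1 + e) _
    ((hδ.prodSet (scaleStable_cone Y) (scaleStable_cone Z) hε).congr
      (hilb_cone_joinVariety Y Z).symm)

end Cones

/-! ### Toric varieties -/

section Toric

variable {σ ρ : Type*} [Fintype ρ]

/-- The image of the torus under the monomials given by the columns of `A`. -/
def torusImage (A : Matrix ρ σ ℤ) : Set (σ → ℂ) :=
  Set.range fun (t : ρ → ℂˣ) j => ((∏ i, t i ^ A i j : ℂˣ) : ℂ)

theorem torusImage_subset_cone [Nonempty σ] (A : Matrix ρ σ ℤ) :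
    torusImage A ⊆ cone (toricVariety A) := by
  rintro _ ⟨t, rfl⟩
  have h : (fun j => ((∏ i, t i ^ A i j : ℂˣ) : ℂ)) ≠ 0 := fun h =>
    (∏ i, t i ^ A i (Classical.arbitrary σ) : ℂˣ).ne_zero (congrFun h _)
  exact ⟨h, @subset_closure _ (zariski σ) _ _ ⟨t, h, rfl⟩⟩

/-- Neither the closure nor rescaling of representatives changes which forms vanish. -/
theorem hilb_cone_toricVariety [Fintype σ] [Nonempty σ] (A : Matrix ρ σ ℤ) :
    hilb (cone (toricVariety A)) = hilb (torusImage A) := by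
  rw [toricVariety, hilb_cone_closure]
  refine hilb_congr _ _ fun k f hf => ⟨?_, ?_⟩
  · rintro h _ ⟨t, rfl⟩
    have h0 : (fun j => ((∏ i, t i ^ A i j : ℂˣ) : ℂ)) ≠ 0 := fun h =>
      (∏ i, t i ^ A i (Classical.arbitrary σ) : ℂˣ).ne_zero (congrFun h _)
    exact h _ ⟨h0, t, h0, rfl⟩
  · rintro h v ⟨hv0, t, ht, hmk⟩
    rw [← eval_rep_eq_zero_iff hf v hv0, hmk, eval_rep_eq_zero_iff hf]
    exact h _ ⟨t, rfl⟩

/-- Different blocks involve disjoint sets of parameters, so their monomial vectors can be chosen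
independently. -/
theorem mem_powSet_torusImage_iff {σ' ρ' ι : Type*} [Fintype ρ'] [Finite ι] [DecidableEq ι]
    (A : Matrix ρ σ ℤ) (A' : Matrix ρ' σ' ℤ) (rows : ρ' ≃ ρ × ι) (cols : σ' ≃ σ × ι)
    (h : A'.reindex rows cols = Matrix.blockDiagonal fun _ => A) (v : σ × ι → ℂ) :
    v ∈ powSet (torusImage A) ι ↔ v ∘ cols ∈ torusImage A' := by
  have := Fintype.ofFinite ι
  have key : ∀ (t : ρ × ι → ℂˣ) (s : σ) (i : ι),
      ∏ r, t (rows r) ^ A' r (cols.symm (s, i)) = ∏ r, t (r, i) ^ A r s := by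
    intro t s i
    have hentry : ∀ x : ρ × ι, A' (rows.symm x) (cols.symm (s, i)) =
        if x.2 = i then A x.1 s else 0 := by
      intro x
      have := congrFun (congrFun h x) (s, i)
      rwa [Matrix.reindex_apply, Matrix.submatrix_apply, Matrix.blockDiagonal_apply] at this
    rw [← Equiv.prod_comp rows.symm, Fintype.prod_prod_type]
    refine Finset.prod_congr rfl fun r _ => ?_
    simp only [hentry, Equiv.apply_symm_apply]
    rw [Fintype.prod_eq_single i]
    · simp
    · intro j hj
      simp [hj]
  constructor
  · intro hv
    choose t ht using hv
    refine ⟨fun r => t (rows r).2 (rows r).1, funext fun x => ?_⟩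
    have := key (fun y => t y.2 y.1) (cols x).1 (cols x).2
    rw [Prod.mk.eta, Equiv.symm_apply_apply] at this
    simp only [this]
    exact congrFun (ht (cols x).2) (cols x).1
  · rintro ⟨t, ht⟩ i
    refine ⟨fun r => t (rows.symm (r, i)), funext fun s => ?_⟩
    have := key (t ∘ rows.symm) s i
    simp only [Function.comp_apply, Equiv.symm_apply_apply] at this
    simp only [← this]
    have := congrFun ht (cols.symm (s, i))
    simpa using this

theorem projDegree_toricVariety_blockDiagonal {σ' ρ' : Type*} [Fintype σ] [Nonempty σ]
    [Fintype σ'] [Fintype ρ'] (A : Matrix ρ σ ℤ) (A' : Matrix ρ' σ' ℤ) (N : ℕ)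
    (hA : ScaleStable (torusImage A)) (rows : ρ' ≃ ρ × Fin (N + 1)) (cols : σ' ≃ σ × Fin (N + 1))
    (h : A'.reindex rows cols = Matrix.blockDiagonal fun _ => A) :
    projDegree (toricVariety A') = projDegree (toricVariety A) ^ (N + 1) := by
  have : Nonempty σ' := cols.nonempty
  obtain ⟨v, hv⟩ : (cone (toricVariety A)).Nonempty :=
    ⟨_, torusImage_subset_cone A ⟨1, rfl⟩⟩
  obtain ⟨d, δ, hδ⟩ := exists_hasDegree _ v hv hv.1
  rw [projDegree_eq_of_hasDegree _ d δ hδ]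
  -- One less than the pole order `(N + 1) * (d + 1)` of the power.
  refine projDegree_eq_of_hasDegree _ (N * (d + 1) + d) _ ?_
  have h1 := (hδ.congr (hilb_cone_toricVariety A)).powSet_fin hA N
  rw [show (N + 1) * (d + 1) = N * (d + 1) + d + 1 by ring] at h1
  refine h1.congr ?_
  rw [hilb_cone_toricVariety]
  exact (hilb_reindex cols _ _ (mem_powSet_torusImage_iff A A' rows cols h)).symm

end Toric

/-! ### Joins with a clique -/

section Joins

variable {V W : Type*}

theorem isClique_graphJoin_disjSum (G : SimpleGraph V) (S : Finset W) (C : Finset V) :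
    (graphJoin (⊤ : SimpleGraph W) G).IsClique (S.disjSum C : Set (W ⊕ V)) ↔
      G.IsClique (C : Set V) := by
  constructor
  · intro h u hu v hv huv
    exact h (Finset.inr_mem_disjSum.2 hu) (Finset.inr_mem_disjSum.2 hv)
      (Sum.inr_injective.ne huv)
  · rintro h (u | u) hu (v | v) hv huv
    · exact fun h' => huv (congrArg _ h')
    · trivial
    · trivial
    · exact h (Finset.inr_mem_disjSum.1 hu) (Finset.inr_mem_disjSum.1 hv)
        fun h' => huv (congrArg _ h')

/-- Vertices of the complete graph are adjacent to all others, so they can be added to any clique;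
only the part in `G` is constrained. -/
theorem maximal_isClique_graphJoin_disjSum [Fintype W] (G : SimpleGraph V) (S : Finset W)
    (C : Finset V) :
    Maximal (fun s : Finset (W ⊕ V) => (graphJoin (⊤ : SimpleGraph W) G).IsClique (s : Set _))
      (S.disjSum C) ↔
      S = Finset.univ ∧ Maximal (fun s : Finset V => G.IsClique (s : Set V)) C := by
  constructor
  · rintro ⟨h1, h2⟩
    rw [isClique_graphJoin_disjSum] at h1
    refine ⟨?_, h1, fun D hD hCD => ?_⟩
    · have := h2 ((isClique_graphJoin_disjSum G Finset.univ C).2 h1)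
        (Finset.disjSum_mono (Finset.subset_univ S) subset_rfl)
      refine Finset.eq_univ_of_forall fun w => ?_
      exact Finset.inl_mem_disjSum.1 (this (Finset.inl_mem_disjSum.2 (Finset.mem_univ w)))
    · have := h2 ((isClique_graphJoin_disjSum G S D).2 hD) (Finset.disjSum_mono subset_rfl hCD)
      intro v hv
      exact Finset.inr_mem_disjSum.1 (this (Finset.inr_mem_disjSum.2 hv))
  · rintro ⟨rfl, h1, h2⟩
    refine ⟨(isClique_graphJoin_disjSum G _ C).2 h1, fun D hD hCD => ?_⟩
    rw [← D.toLeft_disjSum_toRight] at hD hCD ⊢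
    rw [isClique_graphJoin_disjSum] at hD
    refine Finset.disjSum_mono (Finset.subset_univ _) (h2 hD fun v hv => ?_)
    exact Finset.inr_mem_disjSum.1 (hCD (Finset.inr_mem_disjSum.2 hv))

/-- The row of `A_{K ∨ G}` given by a row of `A_G` and a state of the complete graph `K`. -/
def joinRow [Fintype W] (G : SimpleGraph V) (e : W → ℕ) (d : V → ℕ) (r : Row G d × State e) :
    Row (graphJoin (⊤ : SimpleGraph W) G) (Sum.elim e d) :=
  ⟨⟨Finset.univ.disjSum r.1.1.1,
      (maximal_isClique_graphJoin_disjSum G _ _).2 ⟨rfl, r.1.1.2⟩⟩,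
    fun v => match v with
      | ⟨Sum.inl w, _⟩ => r.2 w
      | ⟨Sum.inr u, hu⟩ => r.1.2 ⟨u, Finset.inr_mem_disjSum.1 hu⟩⟩

theorem joinRow_bijective [Fintype W] (G : SimpleGraph V) (e : W → ℕ) (d : V → ℕ) :
    Function.Bijective (joinRow G e d) := by
  constructor
  · rintro ⟨⟨⟨C, hC⟩, a⟩, b⟩ ⟨⟨⟨C', hC'⟩, a'⟩, b'⟩ h
    have h1 : C = C' := by
      have := congrArg (fun r => r.1.1) h
      exact (Finset.disjSum_inj.1 this).2
    subst h1
    have h2 := eq_of_heq (Sigma.mk.inj h).2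
    have ha : a = a' := by
      funext u
      exact congrFun h2 ⟨Sum.inr u.1, Finset.inr_mem_disjSum.2 u.2⟩
    have hb : b = b' := by
      funext w
      exact congrFun h2 ⟨Sum.inl w, Finset.inl_mem_disjSum.2 (Finset.mem_univ w)⟩
    rw [ha, hb]
  · rintro ⟨⟨D, hD⟩, a⟩
    obtain ⟨S, C, rfl⟩ : ∃ S C, D = Finset.disjSum S C := ⟨_, _, D.toLeft_disjSum_toRight.symm⟩
    obtain ⟨rfl, hC⟩ := (maximal_isClique_graphJoin_disjSum G S C).1 hD
    refine ⟨⟨⟨⟨C, hC⟩, fun u => a ⟨Sum.inr u.1, Finset.inr_mem_disjSum.2 u.2⟩⟩,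
      fun w => a ⟨Sum.inl w, Finset.inl_mem_disjSum.2 (Finset.mem_univ w)⟩⟩, ?_⟩
    refine Sigma.ext rfl (heq_of_eq (funext ?_))
    rintro ⟨w | u, h⟩ <;> rfl

/-- The columns of `A_{K ∨ G}`. -/
def joinState (e : W → ℕ) (d : V → ℕ) : State (Sum.elim e d) ≃ State d × State e :=
  (Equiv.sumPiEquivProdPi fun v => Fin (Sum.elim e d v)).trans (Equiv.prodComm _ _)

-- Agreement on `K ∪ C` is agreement on `K`, which selects the block, together with agreement on
-- `C`, which is the entry of `A_G`.
open Classical in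
theorem paramMatrix_graphJoin [Fintype W] (G : SimpleGraph V) (e : W → ℕ) (d : V → ℕ) :
    (paramMatrix (graphJoin (⊤ : SimpleGraph W) G) (Sum.elim e d)).reindex
      (Equiv.ofBijective _ (joinRow_bijective G e d)).symm (joinState e d) =
      Matrix.blockDiagonal fun _ => paramMatrix G d := by
  ext ⟨r, b⟩ ⟨x, y⟩
  rw [Matrix.reindex_apply, Matrix.submatrix_apply, Matrix.blockDiagonal_apply, Equiv.symm_symm,
    Equiv.ofBijective_apply, paramMatrix, paramMatrix, ← ite_and]
  refine if_congr ?_ rfl rfl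
  constructor
  · intro h
    exact ⟨funext fun w => h ⟨Sum.inl w, Finset.inl_mem_disjSum.2 (Finset.mem_univ w)⟩,
      fun v => h ⟨Sum.inr v.1, Finset.inr_mem_disjSum.2 v.2⟩⟩
  · rintro ⟨rfl, h⟩ ⟨w | u, hv⟩
    · rfl
    · exact h ⟨u, _⟩

theorem exists_maxClique [Finite V] (G : SimpleGraph V) : Nonempty (MaxClique G) := by
  obtain ⟨C, -, hC⟩ := Finite.exists_le_maximal
    (p := fun s : Finset V => G.IsClique (s : Set V)) (a := ∅) (by simp)
  exact ⟨⟨C, hC⟩⟩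

/-- Every monomial contains exactly one parameter belonging to a fixed maximal clique `C₀`;
multiplying all parameters of `C₀` by `c` scales the whole vector by `c`. -/
theorem scaleStable_torusImage_paramMatrix [Finite V] (G : SimpleGraph V) (d : V → ℕ) :
    ScaleStable (torusImage (paramMatrix G d)) := by
  classical
  obtain ⟨C₀⟩ := exists_maxClique G
  rintro c hc _ ⟨t, rfl⟩
  obtain ⟨c, rfl⟩ : ∃ u : ℂˣ, (u : ℂ) = c := ⟨Units.mk0 c hc, rfl⟩
  refine ⟨fun r => if r.1 = C₀ then c * t r else t r, funext fun x => ?_⟩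
  simp only [prod_paramMatrix]
  rw [Pi.smul_apply, smul_eq_mul, ← Units.val_mul]
  congr 1
  have : ∀ C : MaxClique G, (if C = C₀ then c * t ⟨C, fun v => x v⟩
      else t ⟨C, fun v => x v⟩) =
      (if C = C₀ then c else 1) * t ⟨C, fun v => x v⟩ := by
    intro C
    split_ifs <;> simp
  simp only [this, Finset.prod_mul_distrib, Finset.prod_ite_eq', Finset.mem_univ, if_true]

theorem isClique_top_univ [Fintype W] :
    Maximal (fun s : Finset W => (⊤ : SimpleGraph W).IsClique (s : Set W)) Finset.univ :=
  ⟨fun _ _ _ _ h => h, fun _ _ _ => Finset.subset_univ _⟩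

/-- The only maximal clique is the whole vertex set, so each coordinate has its own free parameter
and the torus image is the full coordinate torus. Hence the vanishing ideal of the model is zero. -/
theorem mem_torusImage_paramMatrix_top [Fintype W] (e : W → ℕ) (z : State e → ℂˣ) :
    (fun x => (z x : ℂ)) ∈ torusImage (paramMatrix (⊤ : SimpleGraph W) e) := by
  classical
  refine ⟨fun r => if h : r.1.1 = Finset.univ then
    z fun w => r.2 ⟨w, h ▸ Finset.mem_univ w⟩ else 1, funext fun x => ?_⟩
  simp only [prod_paramMatrix]
  congr 1
  rw [Fintype.prod_eq_single ⟨Finset.univ, isClique_top_univ⟩]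
  · simp
  · intro C hC
    rw [dif_neg]
    exact fun h => hC (Subtype.ext h)

theorem projIdeal_model_top [Fintype W] (e : W → ℕ) [Nonempty (State e)] :
    projIdeal (model (⊤ : SimpleGraph W) e) = ⊥ := by
  rw [eq_bot_iff]
  intro f hf
  refine MvPolynomial.funext_set (fun _ => {0}ᶜ) (fun _ => Set.Finite.infinite_compl
    (Set.finite_singleton 0)) fun x hx => ?_
  rw [map_zero]
  have hx' : ∀ s, x s ≠ 0 := fun s => hx s (Set.mem_univ s)
  exact hf x (torusImage_subset_cone _
    (mem_torusImage_paramMatrix_top e fun s => Units.mk0 (x s) (hx' s)))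

theorem projDim_model_top [Fintype W] (e : W → ℕ) [Nonempty (State e)] :
    projDim (model (⊤ : SimpleGraph W) e) + 1 = Nat.card (State e) := by
  have h : ringKrullDim (coordRing (model (⊤ : SimpleGraph W) e)) = Nat.card (State e) := by
    change ringKrullDim (MvPolynomial (State e) ℂ ⧸ projIdeal _) = _
    rw [projIdeal_model_top,
      ringKrullDim_eq_of_ringEquiv (RingEquiv.quotientBot (MvPolynomial (State e) ℂ)),
      MvPolynomial.ringKrullDim_of_isNoetherianRing, ringKrullDim_eq_zero_of_field, zero_add]
  have h1 : ((Nat.card (State e) : WithBot ℕ∞).unbotD 0).toNat = Nat.card (State e) := rfl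
  rw [projDim, h, h1]
  -- The truncated subtraction in `projDim` is harmless since there is at least one state.
  exact Nat.sub_add_cancel Nat.card_pos

end Joins

end GraphicalDegree

end

theorem theoremA12 {V : Type*} [Fintype V] (G : SimpleGraph V) (d : V → ℕ) (hd : ∀ v, 1 ≤ d v)
    (p : ℕ) (e : Fin p → ℕ) (he : ∀ w, 1 ≤ e w) :
    (GraphicalDegree.projDegree
        (GraphicalDegree.model (GraphicalDegree.graphJoin (⊤ : SimpleGraph (Fin p)) G)
          (Sum.elim e d)) =
      GraphicalDegree.projDegree (GraphicalDegree.model G d) ^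
        (GraphicalDegree.projDim (GraphicalDegree.model (⊤ : SimpleGraph (Fin p)) e) + 1)) ∧
    (∃ (rows : GraphicalDegree.Row (GraphicalDegree.graphJoin (⊤ : SimpleGraph (Fin p)) G)
            (Sum.elim e d) ≃
          GraphicalDegree.Row G d ×
            Fin (GraphicalDegree.projDim
              (GraphicalDegree.model (⊤ : SimpleGraph (Fin p)) e) + 1))
        (cols : GraphicalDegree.State (Sum.elim e d) ≃
          GraphicalDegree.State d ×
            Fin (GraphicalDegree.projDim
              (GraphicalDegree.model (⊤ : SimpleGraph (Fin p)) e) + 1)),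
      (GraphicalDegree.paramMatrix (GraphicalDegree.graphJoin (⊤ : SimpleGraph (Fin p)) G)
          (Sum.elim e d)).reindex rows cols =
        Matrix.blockDiagonal (fun _ => GraphicalDegree.paramMatrix G d)) ∧
    (∀ (m n : ℕ) (Y : Set (ℙ ℂ (Fin (m + 1) → ℂ))) (Z : Set (ℙ ℂ (Fin (n + 1) → ℂ))),
      GraphicalDegree.IsIrreducibleVariety Y → GraphicalDegree.IsIrreducibleVariety Z →
      GraphicalDegree.projDegree (GraphicalDegree.joinVariety Y Z) =
        GraphicalDegree.projDegree Y * GraphicalDegree.projDegree Z) := by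
  classical
  have : Nonempty (GraphicalDegree.State e) := ⟨fun w => ⟨0, he w⟩⟩
  have : Nonempty (GraphicalDegree.State d) := ⟨fun v => ⟨0, hd v⟩⟩
  -- Renames the block labels: blocks arise indexed by states of the clique, and there are `projDim
  -- + 1` of them.
  let ε : GraphicalDegree.State e ≃ Fin (GraphicalDegree.projDim
      (GraphicalDegree.model (⊤ : SimpleGraph (Fin p)) e) + 1) :=
    Finite.equivFinOfCardEq (GraphicalDegree.projDim_model_top e).symm
  have hblock : ((GraphicalDegree.paramMatrix
      (GraphicalDegree.graphJoin (⊤ : SimpleGraph (Fin p)) G) (Sum.elim e d)).reindex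
      ((Equiv.ofBijective _ (GraphicalDegree.joinRow_bijective G e d)).symm.trans
        (Equiv.prodCongrRight fun _ => ε))
      ((GraphicalDegree.joinState e d).trans (Equiv.prodCongrRight fun _ => ε))) =
      Matrix.blockDiagonal fun _ => GraphicalDegree.paramMatrix G d := by
    ext ⟨r, i⟩ ⟨x, j⟩
    have h := congrFun (congrFun (GraphicalDegree.paramMatrix_graphJoin G e d) (r, ε.symm i))
      (x, ε.symm j)
    rw [Matrix.blockDiagonal_apply] at h ⊢
    refine Eq.trans h (if_congr ?_ rfl rfl)
    exact ε.symm.apply_eq_iff_eq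
  refine ⟨?_, ⟨_, _, hblock⟩, fun m n Y Z hY hZ => ?_⟩
  · exact GraphicalDegree.projDegree_toricVariety_blockDiagonal _ _ _
      (GraphicalDegree.scaleStable_torusImage_paramMatrix G d) _ _ hblock
  · exact GraphicalDegree.projDegree_joinVariety Y Z hY.2.1 hZ.2.1
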